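/- Let $E$ and $F$ be (real) Banach lattices, and let $E^*$ be the norm dual of $E$ with the operator norm and the order $f\le g\iff f(x)\le g(x)$ for all $x\ge 0$ in $E$. Definitions. A net $(x_\alpha)$ in $E$ is $un$-null if $\big\||x_\alpha|\wedge u\big\|\to 0$ for every $u\in E^+$. A linear functional $f:E\to\mathbb{R}$ is $un$-continuous if $f(x_\alpha)\to 0$ for every norm bounded $un$-null net $(x_\alpha)$ in $E$. The $wun$-topology on $E$ is the smallest topology for which every $un$-continuous linear functional on $E$ is continuous. A continuous linear operator $T:E\to F$ is Dunford–Pettis if $\|Tx_n\|\to 0$ for every weakly null sequence $(x_n)$ in $E$, and $wun$-Dunford–Pettis if $\|Tx_n\|\to 0$ for every norm bounded sequence $(x_n)$ in $E$ that converges to $0$ in the $wun$-topology. The norm of a Banach lattice is order continuous if $\|x_\alpha\|\to 0$ for every net $x_\alpha\downarrow 0$ (decreasing with infimum $0$). Proposition. If every Dunford–Pettis operator $T:E\to F$ is $wun$-Dunford–Pettis, then the norm of $E^*$ is order continuous or $F=\{0\}$. -/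

import Mathlib

open Filter Topology

universe u v

/-- A net `x` in a Banach lattice is `un`-null if `‖|x i| ⊓ w‖ → 0` for every `w ≥ 0`. -/
def IsUnNull {E : Type u} [NormedAddCommGroup E] [Lattice E]
    {ι : Type u} [Preorder ι] (x : ι → E) : Prop :=
  ∀ w : E, 0 ≤ w → Tendsto (fun i => ‖|x i| ⊓ w‖) atTop (𝓝 0)

/-- A linear functional `f` is `un`-continuous if `f (x i) → 0` for every norm bounded
`un`-null net `x`. -/
def IsUnContinuous {E : Type u} [NormedAddCommGroup E] [NormedSpace ℝ E] [Lattice E]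
    (f : E →ₗ[ℝ] ℝ) : Prop :=
  ∀ (ι : Type u) [Preorder ι] [IsDirectedOrder ι] [Nonempty ι] (x : ι → E),
    (∃ M : ℝ, ∀ i, ‖x i‖ ≤ M) → IsUnNull x → Tendsto (fun i => f (x i)) atTop (𝓝 0)

/-- The `un`-dual of `E`: the set of all `un`-continuous linear functionals on `E`. -/
def unDual (E : Type u) [NormedAddCommGroup E] [NormedSpace ℝ E] [Lattice E] :
    Set (E →ₗ[ℝ] ℝ) :=
  {f | IsUnContinuous f}

/-- The weakly unbounded norm topology: the smallest (coarsest) topology on `E` for which every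
functional in the `un`-dual is continuous. -/
abbrev wunTopology (E : Type u) [NormedAddCommGroup E] [NormedSpace ℝ E] [Lattice E] :
    TopologicalSpace E :=
  ⨅ f ∈ unDual E, TopologicalSpace.induced (fun x : E => f x) inferInstance

/-- A continuous operator is Dunford-Pettis if it maps weakly null sequences to norm null
sequences. -/
def IsDunfordPettis {X : Type u} {Y : Type v} [NormedAddCommGroup X] [NormedSpace ℝ X]
    [NormedAddCommGroup Y] [NormedSpace ℝ Y] (T : X →L[ℝ] Y) : Prop :=
  ∀ x : ℕ → X, Tendsto (fun n => toWeakSpace ℝ X (x n)) atTop (𝓝 0) →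
    Tendsto (fun n => ‖T (x n)‖) atTop (𝓝 0)

/-- A continuous operator on a Banach lattice is `wun`-Dunford-Pettis if it maps norm bounded
`wun`-null sequences to norm null sequences. -/
def IsWunDunfordPettis {E : Type u} {Y : Type v} [NormedAddCommGroup E] [NormedSpace ℝ E]
    [Lattice E] [NormedAddCommGroup Y] [NormedSpace ℝ Y] (T : E →L[ℝ] Y) : Prop :=
  ∀ x : ℕ → E, (∃ M : ℝ, ∀ n, ‖x n‖ ≤ M) → Tendsto x atTop (@nhds E (wunTopology E) 0) →
    Tendsto (fun n => ‖T (x n)‖) atTop (𝓝 0)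

/-- The norm of an ordered normed space `L` is order continuous if `‖x i‖ → 0` for every net
`x` that decreases to `0` (that is, `x` is decreasing with infimum `0`). -/
def HasOrderContinuousNorm (L : Type u) [NormedAddCommGroup L] [PartialOrder L] : Prop :=
  ∀ (ι : Type u) [Preorder ι] [IsDirectedOrder ι] [Nonempty ι] (x : ι → L),
    Antitone x → IsGLB (Set.range x) 0 → Tendsto (fun i => ‖x i‖) atTop (𝓝 0)

/-- The order of the dual of a Banach lattice: `f ≤ g` iff `f x ≤ g x` for all `x ≥ 0`. -/
abbrev dualOrder (E : Type u) [NormedAddCommGroup E] [NormedSpace ℝ E] [Lattice E]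
    [IsOrderedAddMonoid E] : PartialOrder (StrongDual ℝ E) where
  le f g := ∀ x : E, 0 ≤ x → f x ≤ g x
  le_refl _ _ _ := le_rfl
  le_trans _ _ _ hfg hgh x hx := (hfg x hx).trans (hgh x hx)
  le_antisymm f g hfg hgf := by
    have h : ∀ x : E, 0 ≤ x → f x = g x := fun x hx => le_antisymm (hfg x hx) (hgf x hx)
    ext x
    rw [← posPart_sub_negPart x, map_sub, map_sub, h _ (posPart_nonneg x),
      h _ (negPart_nonneg x)]

/-- The norm of the dual Banach lattice of `E` (operator norm, dual order) is order continuous. -/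
def DualHasOrderContinuousNorm (E : Type u) [NormedAddCommGroup E] [NormedSpace ℝ E] [Lattice E]
    [IsOrderedAddMonoid E] : Prop :=
  @HasOrderContinuousNorm (StrongDual ℝ E) _ (dualOrder E)

/-!
Suppose that the norm of `E*` is not order continuous and that `F` contains some `y ≠ 0`. A rank
one operator `φ ⊗ y` is always Dunford–Pettis, so it suffices to find `φ ∈ E*` and a norm bounded
sequence that is `wun`-null but along which `φ` does not tend to zero. A bounded disjoint sequence
of positive elements serves.

Every such sequence `(xₙ)` is `wun`-null (`IsUnContinuous.tendsto_zero_of_disjoint`), even though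
it need not be `un`-null. For `u ≥ 0` write `xₙ = xₙ ⊓ ku + (xₙ - ku)⁺`. The elements `xₙ ⊓ ku` are
disjoint and bounded by `ku`, so any bounded functional is absolutely summable along them. Since
`(xₙ - ku)⁺ ⊓ u ≤ xₙ / k` (`smul_posPart_sub_smul_inf_le`), a `un`-continuous functional is
uniformly small on the remainders when `u` and then `k` are chosen large.

The functional and the sequence come from a net `φᵢ ↓ 0` in `E*` whose norms stay above some
`ε > 0`. Infima in `E*` are pointwise on the positive cone (`tendsto_apply_zero_of_antitone`), so
there are increasing indices `aₙ` and positive `xₙ` in the unit ball with `φ_{aₙ}(xₙ) > ε` and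
`φ_{aₙ}` tiny on `x₀ + ⋯ + xₙ₋₁`. With `S = ∑ 2⁻ⁿ xₙ` the elements
`(xₙ - 4ⁿ (x₀ + ⋯ + xₙ₋₁) - 2⁻ⁿ S)⁺` are disjoint (`posPart_sub_sub_inf_le_zero`), and `φ_{a₀}`,
which dominates every `φ_{aₙ}`, stays away from zero on them (`exists_disjoint_not_tendsto`).
-/

/-! ### Disjoint elements of a vector lattice -/

section LatticeOrderedGroup

variable {G : Type*} [AddCommGroup G] [Lattice G] [IsOrderedAddMonoid G]

lemma inf_add_le_zero {a b c : G} (hc : 0 ≤ c) (hab : a ⊓ b ≤ 0) (hac : a ⊓ c ≤ 0) :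
    a ⊓ (b + c) ≤ 0 := by
  have h : a ⊓ (b + c) ≤ c := calc
    a ⊓ (b + c) ≤ (a + c) ⊓ (b + c) := inf_le_inf_right _ (le_add_of_nonneg_right hc)
    _ = a ⊓ b + c := (inf_add _ _ _).symm
    _ ≤ 0 + c := by gcongr
    _ = c := zero_add c
  exact (le_inf inf_le_left h).trans hac

lemma add_le_of_inf_le_zero {a b u : G} (hab : a ⊓ b ≤ 0) (ha : a ≤ u) (hb : b ≤ u) :
    a + b ≤ u := by
  rw [← inf_add_sup a b]
  calc a ⊓ b + a ⊔ b ≤ 0 + u := add_le_add hab (sup_le ha hb)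
    _ = u := zero_add u

lemma sum_le_of_pairwise_disjoint {u : G} (hu : 0 ≤ u) {y : ℕ → G} (hy : ∀ n, 0 ≤ y n)
    (hyu : ∀ n, y n ≤ u) (hd : ∀ m n, m ≠ n → y m ⊓ y n ≤ 0) (s : Finset ℕ) :
    ∑ n ∈ s, y n ≤ u := by
  classical
  induction s using Finset.induction_on with
  | empty => simpa using hu
  | insert a s ha ih =>
    have key : ∀ t : Finset ℕ, a ∉ t → y a ⊓ ∑ n ∈ t, y n ≤ 0 := by
      intro t
      induction t using Finset.induction_on with
      | empty => intro _; simp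
      | insert b t hb iht =>
        intro hab
        rw [Finset.mem_insert, not_or] at hab
        rw [Finset.sum_insert hb]
        exact inf_add_le_zero (Finset.sum_nonneg fun n _ => hy n) (hd a b hab.1) (iht hab.2)
    rw [Finset.sum_insert ha]
    exact add_le_of_inf_le_zero (key s ha) (hyu a) ih

end LatticeOrderedGroup

section VectorLattice

variable {E : Type*} [AddCommGroup E] [Module ℝ E] [Lattice E] [IsOrderedAddMonoid E]
  [IsOrderedModule ℝ E]

lemma le_smul_of_one_le_of_nonneg {c : ℝ} (hc : 1 ≤ c) {b : E} (hb : 0 ≤ b) : b ≤ c • b := by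
  simpa using smul_le_smul_of_nonneg_right hc hb

lemma smul_inf_le_zero {c : ℝ} (hc : 1 ≤ c) {a b : E} (hb : 0 ≤ b) (hab : a ⊓ b ≤ 0) :
    (c • a) ⊓ b ≤ 0 := by
  have hc0 : 0 < c := by linarith
  have h1 : c⁻¹ • ((c • a) ⊓ b) ≤ a ⊓ b := by
    refine le_inf ?_ ?_
    · calc c⁻¹ • ((c • a) ⊓ b) ≤ c⁻¹ • (c • a) :=
          smul_le_smul_of_nonneg_left inf_le_left (by positivity)
        _ = a := inv_smul_smul₀ hc0.ne' a
    · calc c⁻¹ • ((c • a) ⊓ b) ≤ c⁻¹ • (c • b) :=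
          smul_le_smul_of_nonneg_left (inf_le_right.trans (le_smul_of_one_le_of_nonneg hc hb))
            (by positivity)
        _ = b := inv_smul_smul₀ hc0.ne' b
  have h2 := smul_le_smul_of_nonneg_left (h1.trans hab) hc0.le
  rwa [smul_inv_smul₀ hc0.ne', smul_zero] at h2

/-- The part of `x` exceeding a large multiple of `u` meets `u` only in a small element: where
`x` exceeds `c • u`, the element `u` is at most `c⁻¹ • x`. -/
lemma smul_posPart_sub_smul_inf_le {c : ℝ} (hc : 1 ≤ c) {x u : E} (hx : 0 ≤ x) (hu : 0 ≤ u) :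
    c • ((x - c • u)⁺ ⊓ u) ≤ x := by
  have hc0 : 0 ≤ c := by linarith
  set z := x - c • u with hz
  have hneg : z⁻ ≤ c • u := by
    refine sup_le ?_ (smul_nonneg hc0 hu)
    rw [hz, neg_sub]
    exact sub_le_self _ hx
  have hd : (c • (z⁺ ⊓ u)) ⊓ z⁻ ≤ 0 :=
    smul_inf_le_zero hc (negPart_nonneg z)
      ((inf_le_inf_right _ inf_le_left).trans (posPart_inf_negPart_eq_zero z).le)
  have h1 : c • (z⁺ ⊓ u) + z⁻ ≤ c • u :=
    add_le_of_inf_le_zero hd (smul_le_smul_of_nonneg_left inf_le_right hc0) hneg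
  have h2 : c • u = z⁻ + (x - z⁺) := calc
    c • u = x - z := (sub_sub_cancel x _).symm
    _ = x - (z⁺ - z⁻) := by rw [posPart_sub_negPart]
    _ = z⁻ + (x - z⁺) := by abel
  rw [h2, add_comm] at h1
  exact (le_of_add_le_add_left h1).trans (sub_le_self _ (posPart_nonneg z))

/-- If `x n` are positive, `z n` dominates the earlier terms and `S` dominates all terms up to
scaling, then subtracting large multiples of `z n` and small multiples of `S` makes the sequence
disjoint. -/
lemma posPart_sub_sub_inf_le_zero {x z : ℕ → E} {S : E} (hz0 : ∀ n, 0 ≤ z n) (hS0 : 0 ≤ S)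
    (hx : ∀ n, 0 ≤ x n) (hz : ∀ m n, m < n → x m ≤ z n)
    (hS : ∀ n, ((1 / 2 : ℝ) ^ n) • x n ≤ S) {m n : ℕ} (hmn : m < n) :
    (x m - (4 : ℝ) ^ m • z m - ((1 / 2 : ℝ) ^ m) • S)⁺ ⊓
      (x n - (4 : ℝ) ^ n • z n - ((1 / 2 : ℝ) ^ n) • S)⁺ ≤ 0 := by
  -- The two elements lie below the negative and the positive part of the same element `w`.
  set c : ℝ := 2 ^ (m + n) with hc
  have hc0 : 0 < c := by positivity
  have hc1 : 1 ≤ c := one_le_pow₀ (by norm_num)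
  set w := x n - c • x m with hw
  have h1 : (x n - (4 : ℝ) ^ n • z n - ((1 / 2 : ℝ) ^ n) • S)⁺ ≤ w⁺ := by
    refine posPart_mono ?_
    have h4 : c ≤ 4 ^ n := by
      rw [hc, show (4 : ℝ) = 2 ^ 2 by norm_num, ← pow_mul]
      exact pow_le_pow_right₀ (by norm_num) (by omega)
    have : c • x m ≤ (4 : ℝ) ^ n • z n :=
      (smul_le_smul_of_nonneg_right h4 (hx m)).trans
        (smul_le_smul_of_nonneg_left (hz m n hmn) (by positivity))
    exact (sub_le_self _ (smul_nonneg (by positivity) hS0)).trans (sub_le_sub_left this _)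
  have h2 : (x m - (4 : ℝ) ^ m • z m - ((1 / 2 : ℝ) ^ m) • S)⁺ ≤ w⁻ := by
    have hcS : c⁻¹ • x n ≤ ((1 / 2 : ℝ) ^ m) • S := by
      have : c⁻¹ = (1 / 2 : ℝ) ^ m * (1 / 2) ^ n := by
        rw [hc, ← pow_add, one_div, inv_pow]
      rw [this, mul_smul]
      exact smul_le_smul_of_nonneg_left (hS n) (by positivity)
    have hw' : x m - c⁻¹ • x n = c⁻¹ • (-w) := by
      rw [hw, neg_sub, smul_sub, inv_smul_smul₀ hc0.ne']
    refine sup_le ?_ (negPart_nonneg w)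
    calc x m - (4 : ℝ) ^ m • z m - ((1 / 2 : ℝ) ^ m) • S
        ≤ x m - c⁻¹ • x n :=
          sub_le_sub (sub_le_self _ (smul_nonneg (by positivity) (hz0 m))) hcS
      _ = c⁻¹ • (-w) := hw'
      _ ≤ c⁻¹ • w⁻ := smul_le_smul_of_nonneg_left (neg_le_negPart w) (by positivity)
      _ ≤ (1 : ℝ) • w⁻ :=
          smul_le_smul_of_nonneg_right (inv_le_one_of_one_le₀ hc1) (negPart_nonneg w)
      _ = w⁻ := one_smul _ _
  calc _ ≤ w⁻ ⊓ w⁺ := inf_le_inf h2 h1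
    _ ≤ 0 := by rw [inf_comm, posPart_inf_negPart_eq_zero]

end VectorLattice

/-! ### Functionals that are `un`-continuous -/

section UnContinuous

variable {E : Type u} [NormedAddCommGroup E] [NormedSpace ℝ E] [Lattice E] [IsOrderedAddMonoid E]
  [HasSolidNorm E]

/-- The quantitative form of `un`-continuity: on a norm bounded set, `f` is small on a basic
`un`-neighbourhood of zero. -/
lemma IsUnContinuous.exists_abs_lt {f : E →ₗ[ℝ] ℝ} (hf : IsUnContinuous f) (M : ℝ) {ε : ℝ}
    (hε : 0 < ε) :
    ∃ u : E, 0 ≤ u ∧ ∃ δ : ℝ, 0 < δ ∧ ∀ x : E, ‖x‖ ≤ M → ‖|x| ⊓ u‖ < δ → |f x| < ε := by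
  by_contra! hcon
  -- Counterexamples for all `u` and all `δ = 1 / (n + 1)` form a bounded `un`-null net.
  choose x hxM hxu hxf using fun i : {u : E // 0 ≤ u} × ℕ =>
    hcon i.1 i.1.2 (1 / ((i.2 : ℝ) + 1)) (by positivity)
  have : Nonempty {u : E // 0 ≤ u} := ⟨⟨0, le_rfl⟩⟩
  have : IsDirectedOrder {u : E // 0 ≤ u} :=
    ⟨fun a b => ⟨⟨a ⊔ b, a.2.trans le_sup_left⟩, le_sup_left, le_sup_right⟩⟩
  have hnull : IsUnNull x := by
    intro w hw
    rw [Metric.tendsto_atTop]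
    intro η hη
    obtain ⟨n, hn⟩ := exists_nat_one_div_lt hη
    refine ⟨(⟨w, hw⟩, n), fun i hi => ?_⟩
    rw [dist_zero_right, norm_norm]
    have h1 : ‖|x i| ⊓ w‖ ≤ ‖|x i| ⊓ (i.1 : E)‖ := by
      refine norm_le_norm_of_abs_le_abs ?_
      rw [abs_of_nonneg (le_inf (abs_nonneg _) hw), abs_of_nonneg (le_inf (abs_nonneg _) i.1.2)]
      exact inf_le_inf_left _ hi.1
    have h2 : 1 / ((i.2 : ℝ) + 1) ≤ 1 / ((n : ℝ) + 1) := by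
      have : (n : ℝ) ≤ i.2 := by exact_mod_cast hi.2
      gcongr
    linarith [hxu i]
  have hlim := hf _ x ⟨M, hxM⟩ hnull
  obtain ⟨i, hi⟩ := ((hlim.abs).eventually_lt_const (by simpa using hε)).exists
  exact absurd hi (not_lt.mpr (hxf i))

lemma IsUnContinuous.exists_bound {f : E →ₗ[ℝ] ℝ} (hf : IsUnContinuous f) :
    ∃ C : ℝ, 0 ≤ C ∧ ∀ x, |f x| ≤ C * ‖x‖ := by
  obtain ⟨u, hu, δ, hδ, h⟩ := hf.exists_abs_lt 1 one_pos
  have hr : 0 < min 1 (δ / 2) := by positivity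
  refine ⟨1 / min 1 (δ / 2), by positivity,
    LinearMap.bound_of_ball_bound' hr 1 f fun z hz => ?_⟩
  rw [mem_closedBall_zero_iff] at hz
  refine (h z (hz.trans (min_le_left _ _)) ?_).le
  have : ‖|z| ⊓ u‖ ≤ ‖z‖ := by
    refine norm_le_norm_of_abs_le_abs ?_
    rw [abs_of_nonneg (le_inf (abs_nonneg _) hu)]
    exact inf_le_left
  linarith [min_le_right 1 (δ / 2)]

/-- A norm bounded functional tends to zero along an order bounded disjoint sequence, because it is
absolutely summable there. -/
lemma tendsto_zero_of_disjoint_of_le {f : E →ₗ[ℝ] ℝ} {C : ℝ} (hC : 0 ≤ C)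
    (hf : ∀ x, |f x| ≤ C * ‖x‖) {y : ℕ → E} {u : E} (hu : 0 ≤ u) (hy : ∀ n, 0 ≤ y n)
    (hyu : ∀ n, y n ≤ u) (hd : ∀ m n, m ≠ n → y m ⊓ y n ≤ 0) :
    Tendsto (fun n => f (y n)) atTop (𝓝 0) := by
  have key : ∀ s : Finset ℕ, ∑ n ∈ s, |f (y n)| ≤ C * ‖u‖ := by
    intro s
    have hsum : ∑ n ∈ s, |f (y n)| = f (∑ n ∈ s, (SignType.sign (f (y n)) : ℝ) • y n) := by
      simp only [map_sum, map_smul, smul_eq_mul, sign_mul_self]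
    have hsign : ∀ n, |(SignType.sign (f (y n)) : ℝ) • y n| ≤ y n := by
      intro n
      rcases SignType.sign (f (y n)) with _ | _ | _ <;> simp [abs_of_nonneg, hy n]
    have hnorm : ‖∑ n ∈ s, (SignType.sign (f (y n)) : ℝ) • y n‖ ≤ ‖u‖ := by
      refine norm_le_norm_of_abs_le_abs ?_
      rw [abs_of_nonneg hu]
      refine le_trans ?_ (sum_le_of_pairwise_disjoint hu hy hyu hd s)
      refine sup_le ?_ ?_
      · exact Finset.sum_le_sum fun n _ => (le_abs_self _).trans (hsign n)
      · rw [← Finset.sum_neg_distrib]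
        exact Finset.sum_le_sum fun n _ => (neg_le_abs _).trans (hsign n)
    rw [hsum]
    exact (le_abs_self _).trans ((hf _).trans (mul_le_mul_of_nonneg_left hnorm hC))
  exact (tendsto_zero_iff_abs_tendsto_zero _).mpr
    (summable_of_sum_le (fun n => abs_nonneg _) key).tendsto_atTop_zero

variable [IsOrderedModule ℝ E]

/-- A `un`-continuous functional tends to zero along every norm bounded disjoint sequence. The
sequence itself need not be `un`-null, but `x n = x n ⊓ k • u + (x n - k • u)⁺`: the first summands
are disjoint and order bounded, and the second ones are uniformly `un`-small for large `k`. -/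
lemma IsUnContinuous.tendsto_zero_of_disjoint {f : E →ₗ[ℝ] ℝ} (hf : IsUnContinuous f)
    {x : ℕ → E} {M : ℝ} (hM : ∀ n, ‖x n‖ ≤ M) (hx : ∀ n, 0 ≤ x n)
    (hd : ∀ m n, m ≠ n → x m ⊓ x n ≤ 0) : Tendsto (fun n => f (x n)) atTop (𝓝 0) := by
  obtain ⟨C, hC, hfC⟩ := hf.exists_bound
  rw [Metric.tendsto_atTop]
  intro ε hε
  obtain ⟨u, hu, δ, hδ, h⟩ := hf.exists_abs_lt M (half_pos hε)
  have hM0 : 0 ≤ M := (norm_nonneg _).trans (hM 0)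
  set k : ℝ := 1 + M / δ with hk
  have hk1 : 1 ≤ k := le_add_of_nonneg_right (by positivity)
  have hk0 : 0 < k := by linarith
  have hku : 0 ≤ k • u := smul_nonneg hk0.le hu
  have hlim : Tendsto (fun n => f (x n ⊓ k • u)) atTop (𝓝 0) :=
    tendsto_zero_of_disjoint_of_le hC hfC hku (fun n => le_inf (hx n) hku)
      (fun n => inf_le_right)
      (fun m n hmn => (inf_le_inf inf_le_left inf_le_left).trans (hd m n hmn))
  obtain ⟨N, hN⟩ := Metric.tendsto_atTop.mp hlim (ε / 2) (half_pos hε)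
  refine ⟨N, fun n hn => ?_⟩
  have h1 := hN n hn
  have h2 : |f (x n - k • u)⁺| < ε / 2 := by
    have hp := posPart_nonneg (x n - k • u)
    apply h
    · refine (norm_le_norm_of_abs_le_abs ?_).trans (hM n)
      rw [abs_of_nonneg hp, abs_of_nonneg (hx n)]
      exact sup_le (sub_le_self _ hku) (hx n)
    · rw [abs_of_nonneg hp]
      have h3 : ‖k • ((x n - k • u)⁺ ⊓ u)‖ ≤ M := by
        refine (norm_le_norm_of_abs_le_abs ?_).trans (hM n)
        rw [abs_of_nonneg (smul_nonneg hk0.le (le_inf hp hu)), abs_of_nonneg (hx n)]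
        exact smul_posPart_sub_smul_inf_le hk1 (hx n) hu
      rw [norm_smul, Real.norm_of_nonneg hk0.le] at h3
      have h4 : k * δ = δ + M := by rw [hk]; field_simp
      refine lt_of_mul_lt_mul_left (a := k) ?_ hk0.le
      linarith
  have hsplit : x n = x n ⊓ k • u + (x n - k • u)⁺ := by
    have : (x n - k • u)⁺ = x n ⊔ k • u - k • u := by
      rw [posPart_def, sup_sub, sub_self]
    rw [this, ← add_sub_assoc, inf_add_sup, add_sub_cancel_right]
  rw [dist_zero_right, Real.norm_eq_abs] at h1 ⊢
  rw [hsplit, map_add]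
  exact (abs_add_le _ _).trans_lt (by linarith)

lemma tendsto_wunTopology_of_disjoint {x : ℕ → E} {M : ℝ} (hM : ∀ n, ‖x n‖ ≤ M)
    (hx : ∀ n, 0 ≤ x n) (hd : ∀ m n, m ≠ n → x m ⊓ x n ≤ 0) :
    Tendsto x atTop (@nhds E (wunTopology E) 0) := by
  simp only [nhds_iInf, nhds_induced, tendsto_iInf, tendsto_comap_iff]
  intro f hf
  rw [map_zero]
  exact IsUnContinuous.tendsto_zero_of_disjoint hf hM hx hd

end UnContinuous

/-! ### Decreasing nets in the dual -/

section Dual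

variable {E : Type u} [NormedAddCommGroup E] [NormedSpace ℝ E] [Lattice E] [IsOrderedAddMonoid E]

lemma abs_apply_le_of_nonneg {φ : StrongDual ℝ E} (hφ : ∀ x, 0 ≤ x → 0 ≤ φ x) (x : E) :
    |φ x| ≤ φ |x| := by
  refine abs_le.mpr ⟨?_, ?_⟩
  · have := hφ _ (sub_nonneg.mpr (neg_le.mpr (neg_le_abs x)))
    rw [map_sub, map_neg] at this
    linarith
  · have := hφ _ (sub_nonneg.mpr (le_abs_self x))
    rw [map_sub] at this
    linarith

variable [HasSolidNorm E]

lemma norm_le_norm_of_nonneg_of_le {φ ψ : StrongDual ℝ E} (hφ : ∀ x, 0 ≤ x → 0 ≤ φ x)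
    (hφψ : ∀ x, 0 ≤ x → φ x ≤ ψ x) : ‖φ‖ ≤ ‖ψ‖ := by
  refine φ.opNorm_le_bound (norm_nonneg _) fun x => ?_
  calc ‖φ x‖ ≤ φ |x| := abs_apply_le_of_nonneg hφ x
    _ ≤ ψ |x| := hφψ _ (abs_nonneg x)
    _ ≤ ‖ψ |x|‖ := le_abs_self _
    _ ≤ ‖ψ‖ * ‖x‖ := by
      simpa only [norm_abs_eq_norm x] using ψ.le_opNorm |x|

lemma exists_nonneg_lt_apply {φ : StrongDual ℝ E} (hφ : ∀ x, 0 ≤ x → 0 ≤ φ x) {r : ℝ}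
    (hr : r < ‖φ‖) : ∃ x : E, 0 ≤ x ∧ ‖x‖ ≤ 1 ∧ r < φ x := by
  obtain ⟨x, hx, hrx⟩ := φ.exists_lt_apply_of_lt_opNorm hr
  exact ⟨|x|, abs_nonneg x, (norm_abs_eq_norm x).trans_le hx.le,
    hrx.trans_le (abs_apply_le_of_nonneg hφ x)⟩

variable {ι : Type*} [Preorder ι] [IsDirectedOrder ι] [Nonempty ι]

/-- Infima of decreasing nets of positive functionals are computed pointwise on the positive cone:
the pointwise limit is itself a continuous functional, and a lower bound of the net. -/
lemma tendsto_apply_zero_of_antitone {φ : ι → StrongDual ℝ E}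
    (hanti : ∀ i j, i ≤ j → ∀ x, 0 ≤ x → φ j x ≤ φ i x) (hpos : ∀ i x, 0 ≤ x → 0 ≤ φ i x)
    (hinf : ∀ ψ : StrongDual ℝ E, (∀ i x, 0 ≤ x → ψ x ≤ φ i x) → ∀ x, 0 ≤ x → ψ x ≤ 0)
    {x : E} (hx : 0 ≤ x) : Tendsto (fun i => φ i x) atTop (𝓝 0) := by
  have hlim0 : ∀ x : E, 0 ≤ x → Tendsto (fun i => φ i x) atTop (𝓝 (⨅ i, φ i x)) := by
    intro x hx
    refine tendsto_atTop_ciInf (fun i j hij => hanti i j hij x hx) ⟨0, ?_⟩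
    rintro _ ⟨i, rfl⟩
    exact hpos i x hx
  have hlim : ∀ x : E, Tendsto (fun i => φ i x) atTop
      (𝓝 ((⨅ i, φ i x⁺) - ⨅ i, φ i x⁻)) := by
    intro x
    refine ((hlim0 _ (posPart_nonneg x)).sub (hlim0 _ (negPart_nonneg x))).congr fun i => ?_
    rw [← map_sub, posPart_sub_negPart]
  let ψ₀ : E →ₗ[ℝ] ℝ :=
    linearMapOfTendsto _ (fun i => (φ i : E →ₗ[ℝ] ℝ)) (tendsto_pi_nhds.mpr hlim)
  have hψ₀ : ∀ x, Tendsto (fun i => φ i x) atTop (𝓝 (ψ₀ x)) := hlim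
  obtain ⟨i₀⟩ := ‹Nonempty ι›
  let ψ : StrongDual ℝ E := ψ₀.mkContinuous ‖φ i₀‖ fun x => by
    refine le_of_tendsto (hψ₀ x).norm ?_
    filter_upwards [eventually_ge_atTop i₀] with i hi
    exact (φ i).le_of_opNorm_le
      (norm_le_norm_of_nonneg_of_le (hpos i) (hanti i₀ i hi)) x
  have hψ : ψ x = 0 := by
    refine le_antisymm (hinf ψ (fun i x hx => ?_) x hx)
      (ge_of_tendsto' (hψ₀ x) fun i => hpos i x hx)
    refine le_of_tendsto (hψ₀ x) ?_
    filter_upwards [eventually_ge_atTop i] with j hj using hanti i j hj x hx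
  exact hψ ▸ hψ₀ x

omit [HasSolidNorm E] in
/-- From a net of functionals that tends to zero pointwise on the positive cone, together with a
positive element `X i` for each index, one can extract an increasing sequence of indices along which
each functional is as small as prescribed at the sum of the earlier elements. -/
lemma exists_seq_apply_sum_le {φ : ι → StrongDual ℝ E} {X : ι → E} (hX : ∀ i, 0 ≤ X i)
    (hφ : ∀ x : E, 0 ≤ x → Tendsto (fun i => φ i x) atTop (𝓝 0)) {δ : ℕ → ℝ}
    (hδ : ∀ n, 0 < δ n) :
    ∃ a : ℕ → ι, Monotone a ∧ ∀ n, φ (a n) (∑ m ∈ Finset.range n, X (a m)) ≤ δ n := by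
  have step : ∀ (n : ℕ) (p : ι × {z : E // 0 ≤ z}),
      ∃ j, p.1 ≤ j ∧ φ j (p.2 + X p.1) ≤ δ (n + 1) := by
    intro n p
    have h := (hφ _ (add_nonneg p.2.2 (hX p.1))).eventually_lt_const (hδ (n + 1))
    obtain ⟨j, hj, hj'⟩ := ((eventually_ge_atTop p.1).and h).exists
    exact ⟨j, hj, hj'.le⟩
  choose next hnext hnextδ using step
  obtain ⟨i₀⟩ := ‹Nonempty ι›
  -- The state consists of the current index and the sum of the elements at the earlier indices.
  let p : ℕ → ι × {z : E // 0 ≤ z} := fun n =>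
    Nat.rec (i₀, ⟨0, le_rfl⟩)
      (fun n q => (next n q, ⟨q.2 + X q.1, add_nonneg q.2.2 (hX q.1)⟩)) n
  have hsum : ∀ n, ((p n).2 : E) = ∑ m ∈ Finset.range n, X (p m).1 := by
    intro n
    induction n with
    | zero => rfl
    | succ n ih => rw [Finset.sum_range_succ, ← ih]
  refine ⟨fun n => (p n).1, monotone_nat_of_le_succ fun n => hnext n (p n), fun n => ?_⟩
  rw [← hsum]
  cases n with
  | zero => simpa [p] using (hδ 0).le
  | succ n => exact hnextδ n (p n)

variable [CompleteSpace E] [IsOrderedModule ℝ E]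

/-- If a net of positive functionals decreases to zero pointwise but is bounded away from zero in
norm, some functional in it does not tend to zero along a suitable norm bounded disjoint
sequence. -/
lemma exists_disjoint_not_tendsto {φ : ι → StrongDual ℝ E}
    (hanti : ∀ i j, i ≤ j → ∀ x, 0 ≤ x → φ j x ≤ φ i x) (hpos : ∀ i x, 0 ≤ x → 0 ≤ φ i x)
    (hlim : ∀ x : E, 0 ≤ x → Tendsto (fun i => φ i x) atTop (𝓝 0)) {ε : ℝ} (hε : 0 < ε)
    (hnorm : ∀ i, ε < ‖φ i‖) :
    ∃ (i : ι) (y : ℕ → E), (∀ n, 0 ≤ y n) ∧ (∀ n, ‖y n‖ ≤ 1) ∧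
      (∀ m n, m ≠ n → y m ⊓ y n ≤ 0) ∧ ¬ Tendsto (fun n => φ i (y n)) atTop (𝓝 0) := by
  choose X hX0 hX1 hXφ using fun i => exists_nonneg_lt_apply (hpos i) (hnorm i)
  obtain ⟨a, ha, haδ⟩ := exists_seq_apply_sum_le hX0 hlim
    (δ := fun n => ε / 2 * (1 / 4) ^ n) (fun n => by positivity)
  set x : ℕ → E := fun n => X (a n) with hxdef
  set z : ℕ → E := fun n => ∑ m ∈ Finset.range n, x m with hzdef
  have hx : ∀ n, 0 ≤ x n := fun n => hX0 _
  have hz0 : ∀ n, 0 ≤ z n := fun n => Finset.sum_nonneg fun m _ => hx m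
  have hz : ∀ m n, m < n → x m ≤ z n := fun m n hmn =>
    Finset.single_le_sum (f := x) (fun m _ => hx m) (Finset.mem_range.mpr hmn)
  have hx' : ∀ n, 0 ≤ ((1 / 2 : ℝ) ^ n) • x n := fun n => smul_nonneg (by positivity) (hx n)
  have hsum : Summable fun n => ((1 / 2 : ℝ) ^ n) • x n := by
    refine Summable.of_norm_bounded summable_geometric_two fun n => ?_
    rw [norm_smul, Real.norm_of_nonneg (by positivity)]
    exact mul_le_of_le_one_right (by positivity) (hX1 _)
  set S : E := ∑' n, ((1 / 2 : ℝ) ^ n) • x n with hSdef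
  have hS0 : 0 ≤ S := tsum_nonneg hx'
  have hS : ∀ n, ((1 / 2 : ℝ) ^ n) • x n ≤ S := fun n => hsum.le_tsum n fun m _ => hx' m
  set v : ℕ → E := fun n => x n - (4 : ℝ) ^ n • z n - ((1 / 2 : ℝ) ^ n) • S with hv
  have hvx : ∀ n, (v n)⁺ ≤ x n := fun n =>
    sup_le ((sub_le_self _ (smul_nonneg (by positivity) hS0)).trans
      (sub_le_self _ (smul_nonneg (by positivity) (hz0 n)))) (hx n)
  refine ⟨a 0, fun n => (v n)⁺, fun n => posPart_nonneg _, fun n => ?_, fun m n hmn => ?_, ?_⟩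
  · refine (norm_le_norm_of_abs_le_abs ?_).trans (hX1 (a n))
    rw [abs_of_nonneg (posPart_nonneg _), abs_of_nonneg (hX0 _)]
    exact hvx n
  · rcases lt_or_gt_of_ne hmn with h | h
    · exact posPart_sub_sub_inf_le_zero hz0 hS0 hx hz hS h
    · rw [inf_comm]
      exact posPart_sub_sub_inf_le_zero hz0 hS0 hx hz hS h
  · intro htend
    have hlow : ∀ n, ε / 2 - (1 / 2) ^ n * φ (a 0) S ≤ φ (a 0) (v n)⁺ := by
      intro n
      have h0 := ha (Nat.zero_le n)
      have h1 : φ (a n) (v n)⁺ ≤ φ (a 0) (v n)⁺ := hanti _ _ h0 _ (posPart_nonneg _)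
      have h2 : φ (a n) S ≤ φ (a 0) S := hanti _ _ h0 _ hS0
      have h3 : φ (a n) (v n) ≤ φ (a n) (v n)⁺ := by
        have := hpos (a n) _ (sub_nonneg.mpr (le_posPart (v n)))
        rw [map_sub] at this
        linarith
      have h4 : φ (a n) (v n) =
          φ (a n) (x n) - 4 ^ n * φ (a n) (z n) - (1 / 2) ^ n * φ (a n) S := by
        simp only [hv, map_sub, map_smul, smul_eq_mul]
      have h5 : ε < φ (a n) (x n) := hXφ (a n)
      have h6 : 4 ^ n * φ (a n) (z n) ≤ ε / 2 := by
        calc 4 ^ n * φ (a n) (z n) ≤ 4 ^ n * (ε / 2 * (1 / 4) ^ n) :=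
              mul_le_mul_of_nonneg_left (haδ n) (by positivity)
          _ = ε / 2 * (4 * (1 / 4)) ^ n := by rw [mul_pow]; ring
          _ = ε / 2 := by norm_num
      have h7 : (1 / 2 : ℝ) ^ n * φ (a n) S ≤ (1 / 2) ^ n * φ (a 0) S :=
        mul_le_mul_of_nonneg_left h2 (by positivity)
      linarith
    have hlow_lim : Tendsto (fun n : ℕ => ε / 2 - (1 / 2 : ℝ) ^ n * φ (a 0) S) atTop
        (𝓝 (ε / 2 - 0 * φ (a 0) S)) :=
      ((tendsto_pow_atTop_nhds_zero_of_lt_one (by norm_num) (by norm_num)).mul_const _).const_sub _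
    have := le_of_tendsto_of_tendsto' hlow_lim htend hlow
    linarith

lemma exists_disjoint_of_not_dualHasOrderContinuousNorm
    (hE : ¬ DualHasOrderContinuousNorm E) :
    ∃ (φ : StrongDual ℝ E) (y : ℕ → E), (∀ n, 0 ≤ y n) ∧ (∀ n, ‖y n‖ ≤ 1) ∧
      (∀ m n, m ≠ n → y m ⊓ y n ≤ 0) ∧ ¬ Tendsto (fun n => φ (y n)) atTop (𝓝 0) := by
  unfold DualHasOrderContinuousNorm HasOrderContinuousNorm at hE
  push Not at hE
  obtain ⟨κ, _, _, _, φ, hanti, hglb, hnot⟩ := hE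
  have hanti' : ∀ i j, i ≤ j → ∀ x, 0 ≤ x → φ j x ≤ φ i x := fun i j hij => hanti hij
  have hpos : ∀ i x, 0 ≤ x → 0 ≤ φ i x := fun i x hx => by
    simpa using hglb.1 (Set.mem_range_self i) x hx
  have hlim : ∀ x : E, 0 ≤ x → Tendsto (fun i => φ i x) atTop (𝓝 0) := fun x hx =>
    tendsto_apply_zero_of_antitone hanti' hpos
      (fun ψ hψ => hglb.2 (by rintro _ ⟨i, rfl⟩; exact hψ i)) hx
  -- The norms decrease, so failing to tend to zero they stay away from it.
  have hε : ∃ ε > 0, ∀ i, ε < ‖φ i‖ := by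
    by_contra! hcon
    refine hnot (Metric.tendsto_nhds.mpr fun ε hε => ?_)
    obtain ⟨i, hi⟩ := hcon (ε / 2) (half_pos hε)
    filter_upwards [eventually_ge_atTop i] with j hj
    rw [dist_zero_right, norm_norm]
    linarith [norm_le_norm_of_nonneg_of_le (hpos j) (hanti' i j hj)]
  obtain ⟨ε, hε, hnorm⟩ := hε
  obtain ⟨i, y, hy⟩ := exists_disjoint_not_tendsto hanti' hpos hlim hε hnorm
  exact ⟨φ i, y, hy⟩

end Dual

/-! ### Operators of rank one -/

lemma isDunfordPettis_smulRight {X : Type u} {Y : Type v} [NormedAddCommGroup X] [NormedSpace ℝ X]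
    [NormedAddCommGroup Y] [NormedSpace ℝ Y] (φ : StrongDual ℝ X) (y : Y) :
    IsDunfordPettis (φ.smulRight y) := by
  intro x hx
  have hcont : Continuous fun w : WeakSpace ℝ X => φ ((toWeakSpace ℝ X).symm w) :=
    WeakBilin.eval_continuous _ φ
  have h : Tendsto (fun n => φ (x n)) atTop (𝓝 0) := by
    have := (hcont.tendsto 0).comp hx
    rwa [map_zero, map_zero] at this
  simpa [norm_smul] using h.norm.mul_const ‖y‖

theorem mainTheorem3
    (E : Type u) [NormedAddCommGroup E] [NormedSpace ℝ E] [CompleteSpace E]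
    [Lattice E] [IsOrderedAddMonoid E] [IsOrderedModule ℝ E] [HasSolidNorm E]
    (F : Type v) [NormedAddCommGroup F] [NormedSpace ℝ F] [CompleteSpace F]
    [Lattice F] [IsOrderedAddMonoid F] [IsOrderedModule ℝ F] [HasSolidNorm F]
    (h : ∀ T : E →L[ℝ] F, IsDunfordPettis T → IsWunDunfordPettis T) :
    DualHasOrderContinuousNorm E ∨ ∀ y : F, y = 0 := by
  by_contra! hcon
  obtain ⟨hE, y, hy⟩ := hcon
  obtain ⟨φ, x, hx0, hx1, hd, hφ⟩ := exists_disjoint_of_not_dualHasOrderContinuousNorm hE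
  have hT := h _ (isDunfordPettis_smulRight φ y) x ⟨1, hx1⟩
    (tendsto_wunTopology_of_disjoint hx1 hx0 hd)
  refine hφ (tendsto_zero_iff_norm_tendsto_zero.mpr ?_)
  have hy' : ‖y‖ ≠ 0 := norm_ne_zero_iff.mpr hy
  simpa [norm_smul, mul_div_cancel_right₀ _ hy'] using hT.div_const ‖y‖
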